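/- For $L\in\mathbb{Q}$ put $f_L(x)=x(x-1)(x-L)$ and let $E_L$ be the curve $y^2=f_L(x)$. Call $E_L$ a nice elliptic curve if $L\neq 0,1$ and $L^2-L+1$ is the square of a rational number. Proposition. Let $u\in\mathbb{Q}\setminus\{0,1,-1\}$ and $$L=\frac{(u^2+3)(u^2-1)}{4u^2}.$$ Then $E_L$ is a nice elliptic curve, and the derivative $f_L'$ has exactly two distinct roots $r<s$, both rational. Moreover: (a) $f_L(r)$ is the square of a rational number, and $(r,\sqrt{f_L(r)})$ is a rational point of infinite order of $E_L$, that is, a point of infinite order in $E_L(\mathbb{Q})$; (b) $f_L(s)$ is a square in $\mathbb{Q}(\sqrt{-3})$, and $(s,\sqrt{f_L(s)})$ is a point of infinite order in $E_L(\mathbb{Q}(\sqrt{-3}))$. Both assertions hold for either choice of the sign of the square root. -/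

import Mathlib

open Polynomial

/-- The cubic polynomial `f_L(x) = x (x - 1) (x - L)` over `ℚ`. -/
noncomputable def legendreCubic (L : ℚ) : ℚ[X] := X * (X - 1) * (X - C L)

/-- The curve `E_L : y² = f_L(x)`, i.e. `y² = x³ - (1 + L) x² + L x`, over `ℚ`. -/
def legendreCurve (L : ℚ) : WeierstrassCurve ℚ :=
  { a₁ := 0, a₂ := -(1 + L), a₃ := 0, a₄ := L, a₆ := 0 }

/-- The affine equation of `legendreCurve L` is `y² = f_L(x)`. -/
theorem legendreCurve_equation_iff (L x y : ℚ) :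
    (legendreCurve L).toAffine.Equation x y ↔ y ^ 2 = (legendreCubic L).eval x := by
  rw [WeierstrassCurve.Affine.equation_iff]
  simp only [legendreCurve, legendreCubic, eval_mul, eval_sub, eval_X, eval_one, eval_C]
  constructor <;> intro h <;> linear_combination h

/-- `E_L` is a nice elliptic curve: `L` is a rational number other than `0` and `1`, and
`L² - L + 1` is the square of a rational number. -/
def IsNiceParameter (L : ℚ) : Prop :=
  L ≠ 0 ∧ L ≠ 1 ∧ IsSquare (L ^ 2 - L + 1)

/-- The field `ℚ(√-3)`, as a subfield of `ℂ`. -/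
noncomputable abbrev QSqrtNegThree : IntermediateField ℚ ℂ :=
  IntermediateField.adjoin ℚ {((Real.sqrt 3 : ℝ) : ℂ) * Complex.I}

/-- `(x, y)` is a (nonsingular) point of the curve `W` over the field `F`, and it has infinite order
in the group `W(F)`. -/
def IsPointOfInfiniteOrder {F : Type*} [Field F] [DecidableEq F] (W : WeierstrassCurve F)
    (x y : F) : Prop :=
  ∃ h : W.toAffine.Nonsingular x y,
    ¬ IsOfFinAddOrder (WeierstrassCurve.Affine.Point.some x y h : W.toAffine.Point)

/-! The proof is 2-adic. Once `|x|₂` exceeds both `1` and `|L|₂`, the leading terms of the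
duplication formula dominate, and the `4` in its denominator gives `|x(2P)|₂ = 4 |x(P)|₂`. The
points `2 ^ k • P` then have distinct `x`-coordinates, so `P` has infinite order
(`not_isOfFinAddOrder_of_padicNorm_lt`). Doubling keeps `x` rational even when `y` is not, so the
argument needs only the norm on `ℚ` and also covers `ℚ(√-3)`. For the points above `r` and `s` the
double never lies in this region (there `|x|₂` is `1` or equals `|L|₂`), but the quadruple always
does (`padicNorm_quadruple_smaller`, `padicNorm_quadruple_larger`). -/

/-- The `x`-coordinate of the double of a point of `E_L` with `x`-coordinate `x`. -/
def duplicationX (L x : ℚ) : ℚ :=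
  (x ^ 2 - L) ^ 2 / (4 * (x * (x - 1) * (x - L)))

/-! ### 2-adic norms of rationals. -/

section Norm

theorem padicNorm_add_eq_left {p : ℕ} [Fact p.Prime] {a b : ℚ}
    (h : padicNorm p b < padicNorm p a) : padicNorm p (a + b) = padicNorm p a := by
  rw [padicNorm.add_eq_max_of_ne h.ne', max_eq_left h.le]

theorem padicNorm_sub_eq_left {p : ℕ} [Fact p.Prime] {a b : ℚ}
    (h : padicNorm p b < padicNorm p a) : padicNorm p (a - b) = padicNorm p a := by
  rw [sub_eq_add_neg, padicNorm_add_eq_left (by rwa [padicNorm.neg])]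

theorem padicNorm_pow {p : ℕ} [Fact p.Prime] (a : ℚ) (n : ℕ) :
    padicNorm p (a ^ n) = padicNorm p a ^ n := by
  induction n with
  | zero => simp
  | succ n ih => rw [pow_succ, pow_succ, padicNorm.mul, ih]

theorem padicNorm_two_two : padicNorm 2 2 = 1 / 2 := by
  have := padicNorm.padicNorm_p_of_prime (p := 2)
  norm_num at this ⊢
  exact this

theorem padicNorm_two_four : padicNorm 2 4 = 1 / 4 := by
  rw [show (4 : ℚ) = 2 ^ 2 by norm_num, padicNorm_pow, padicNorm_two_two]
  norm_num

theorem padicNorm_two_three : padicNorm 2 3 = 1 := by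
  exact_mod_cast (padicNorm.nat_eq_one_iff (p := 2) 3).mpr (by norm_num)

/-- The square of a `2`-adic unit is congruent to `1` modulo `8`. -/
theorem padicNorm_two_sq_sub_one_le {u : ℚ} (hu : padicNorm 2 u = 1) :
    padicNorm 2 (u ^ 2 - 1) ≤ 1 / 8 := by
  have hd0 : (u.den : ℚ) ≠ 0 := by exact_mod_cast u.den_ne_zero
  have hmul : u * (u.den : ℚ) = u.num := Rat.mul_den_eq_num u
  have hnorm : padicNorm 2 (u.den : ℤ) = padicNorm 2 u.num := by
    rw [← hmul, padicNorm.mul, hu, one_mul]; simp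
  have hiff : (2 : ℤ) ∣ u.den ↔ (2 : ℤ) ∣ u.num := by
    have h1 := padicNorm.int_lt_one_iff (p := 2) (u.den : ℤ)
    have h2 := padicNorm.int_lt_one_iff (p := 2) u.num
    rw [hnorm] at h1
    exact_mod_cast h1.symm.trans h2
  have hden : ¬ (2 : ℤ) ∣ u.den := by
    intro h
    have h1 : 2 ∣ u.num.natAbs := Int.natCast_dvd.mp (hiff.mp h)
    have h2 : 2 ∣ u.den := by exact_mod_cast h
    have := Nat.dvd_gcd h1 h2
    rw [u.reduced] at this
    omega
  have hnum : ¬ (2 : ℤ) ∣ u.num := fun h => hden (hiff.mpr h)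
  -- Numerator and denominator are both odd, so both squares are `1` modulo `8`.
  have h8 : (8 : ℤ) ∣ u.num ^ 2 - (u.den : ℤ) ^ 2 := by
    have h1 := Int.eight_dvd_sq_sub_one_of_odd (Int.not_even_iff_odd.mp
      (fun h => hnum h.two_dvd))
    have h2 := Int.eight_dvd_sq_sub_one_of_odd (Int.not_even_iff_odd.mp
      (fun h => hden h.two_dvd))
    omega
  have hle := (padicNorm.dvd_iff_norm_le (p := 2) (n := 3)).mp (by exact_mod_cast h8)
  have hden1 : padicNorm 2 (u.den : ℚ) = 1 := by
    have := padicNorm.int_eq_one_iff (p := 2) (u.den : ℤ)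
    simpa using this.mpr (by exact_mod_cast hden)
  have heq : (u ^ 2 - 1) * (u.den : ℚ) ^ 2 = ((u.num ^ 2 - (u.den : ℤ) ^ 2 : ℤ) : ℚ) := by
    push_cast
    rw [← hmul]
    ring
  calc padicNorm 2 (u ^ 2 - 1) = padicNorm 2 ((u ^ 2 - 1) * (u.den : ℚ) ^ 2) := by
        rw [padicNorm.mul, padicNorm_pow, hden1]; simp
    _ ≤ 1 / 8 := by
        rw [heq]
        refine hle.trans (le_of_eq ?_)
        norm_num

end Norm

/-! ### Repeated doubling and infinite order. -/

section InfiniteOrder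

variable {L x : ℚ}

/-- On the region `|x|₂ > max 1 |L|₂` duplication multiplies `|x|₂` by `4`. -/
theorem padicNorm_duplicationX (h1 : 1 < padicNorm 2 x) (hL : padicNorm 2 L < padicNorm 2 x) :
    x * (x - 1) * (x - L) ≠ 0 ∧ padicNorm 2 (duplicationX L x) = 4 * padicNorm 2 x := by
  have e1 : padicNorm 2 (x - 1) = padicNorm 2 x := padicNorm_sub_eq_left (by simpa using h1)
  have e2 : padicNorm 2 (x - L) = padicNorm 2 x := padicNorm_sub_eq_left hL
  have e3 : padicNorm 2 (x ^ 2 - L) = padicNorm 2 x ^ 2 := by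
    rw [padicNorm_sub_eq_left, padicNorm_pow]
    rw [padicNorm_pow]
    nlinarith
  have hx : padicNorm 2 x ≠ 0 := by linarith
  have e4 : padicNorm 2 (x * (x - 1) * (x - L)) = padicNorm 2 x ^ 3 := by
    rw [padicNorm.mul, padicNorm.mul, e1, e2]; ring
  refine ⟨fun h => ?_, ?_⟩
  · rw [h, padicNorm.zero] at e4
    exact hx (pow_eq_zero_iff (by norm_num) |>.mp e4.symm)
  · rw [duplicationX, padicNorm.div, padicNorm.mul, e4, padicNorm_pow, e3, padicNorm_two_four]
    field_simp

variable {K : Type*} [Field K] [DecidableEq K] [Algebra ℚ K] {W : WeierstrassCurve K}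

open WeierstrassCurve.Affine

/-- The tangent slope enters the new `x`-coordinate only through its square, whose denominator `4y²`
equals `4f_L(x)`; hence `y ∈ K` may be irrational. -/
theorem two_nsmul_legendreCurve_map (hW : W = (legendreCurve L).map (algebraMap ℚ K))
    (hx : x * (x - 1) * (x - L) ≠ 0) {y : K}
    (h : W.toAffine.Nonsingular (algebraMap ℚ K x) y) :
    ∃ (y' : K) (h' : W.toAffine.Nonsingular (algebraMap ℚ K (duplicationX L x)) y'),
      2 • Point.some _ _ h = Point.some _ _ h' := by
  have heq : y ^ 2 = algebraMap ℚ K (x * (x - 1) * (x - L)) := by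
    have := (equation_iff _ _).mp h.1
    subst hW
    simp only [WeierstrassCurve.map, legendreCurve, map_zero, map_neg, map_add, map_one] at this
    simp only [map_mul, map_sub, map_one]
    linear_combination this
  have hy2 : y ^ 2 ≠ 0 := by
    rw [heq]; exact (_root_.map_ne_zero _).mpr hx
  have hy : y ≠ 0 := by rintro rfl; simp at hy2
  have : CharZero K := algebraRat.charZero K
  have hneg : W.toAffine.negY (algebraMap ℚ K x) y = -y := by
    subst hW; simp [negY, legendreCurve]
  have hne : y ≠ W.toAffine.negY (algebraMap ℚ K x) y := by
    rw [hneg]; intro h; exact hy (self_eq_neg.mp h)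
  have hX : W.toAffine.addX (algebraMap ℚ K x) (algebraMap ℚ K x)
      (W.toAffine.slope (algebraMap ℚ K x) (algebraMap ℚ K x) y y) =
      algebraMap ℚ K (duplicationX L x) := by
    rw [slope_of_Y_ne rfl hne, hneg, duplicationX, map_div₀, map_mul, ← heq]
    subst hW
    simp only [addX, WeierstrassCurve.map, legendreCurve, map_zero, map_neg, map_add, map_one,
      map_pow, map_sub, map_ofNat]
    simp only [map_mul, map_sub, map_one] at heq
    field_simp
    linear_combination (16 * (1 + algebraMap ℚ K L - 2 * algebraMap ℚ K x)) * heq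
  rw [two_nsmul, Point.add_self_of_Y_ne hne]
  generalize_proofs hns
  revert hns
  rw [hX]
  exact fun hns => ⟨_, hns, rfl⟩

theorem not_isOfFinAddOrder_of_padicNorm_lt (hW : W = (legendreCurve L).map (algebraMap ℚ K))
    (h1 : 1 < padicNorm 2 x) (hL : padicNorm 2 L < padicNorm 2 x) {y : K}
    (h : W.toAffine.Nonsingular (algebraMap ℚ K x) y) :
    ¬ IsOfFinAddOrder (Point.some _ _ h) := by
  have key : ∀ k : ℕ, ∃ (x' : ℚ) (y' : K) (h' : W.toAffine.Nonsingular (algebraMap ℚ K x') y'),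
      padicNorm 2 x' = 4 ^ k * padicNorm 2 x ∧ 2 ^ k • Point.some _ _ h = Point.some _ _ h' := by
    intro k
    induction k with
    | zero => exact ⟨x, y, h, by simp, by simp⟩
    | succ k ih =>
      obtain ⟨x', y', h', hn, hP⟩ := ih
      -- The norm has only grown, so the point is still in the region where the doubling estimate
      -- applies.
      have hle : padicNorm 2 x ≤ padicNorm 2 x' := by
        rw [hn]
        exact le_mul_of_one_le_left (by linarith) (one_le_pow₀ (by norm_num))
      obtain ⟨hf, hd⟩ := padicNorm_duplicationX (h1.trans_le hle) (hL.trans_le hle)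
      obtain ⟨y'', h'', hP'⟩ := two_nsmul_legendreCurve_map hW hf h'
      exact ⟨_, y'', h'', by rw [hd, hn]; ring, by rw [pow_succ, mul_nsmul, hP, hP']⟩
  intro hfin
  -- Finite order would leave only finitely many multiples, yet `k ↦ 2 ^ k • P` is injective because
  -- the norms `4 ^ k * |x|₂` differ.
  refine Set.infinite_of_injective_forall_mem (f := fun k : ℕ => 2 ^ k • Point.some _ _ h)
    ?_ (fun k => ?_) (finite_multiples.mpr hfin)
  · intro a b hab
    obtain ⟨xa, ya, ha, hna, hPa⟩ := key a
    obtain ⟨xb, yb, hb, hnb, hPb⟩ := key b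
    simp only [hPa, hPb, Point.some.injEq] at hab
    have hxx : xa = xb := (algebraMap ℚ K).injective hab.1
    rw [hxx, hnb] at hna
    have := mul_right_cancel₀ (by linarith : padicNorm 2 x ≠ 0) hna
    exact (Nat.pow_right_injective (by norm_num : 2 ≤ 4) (by exact_mod_cast this)).symm
  · exact AddSubmonoid.mem_multiples_iff _ _ |>.mpr ⟨_, rfl⟩

/-- A point whose quadruple has `x`-coordinate in the region `|x|₂ > max 1 |L|₂` has infinite
order. -/
theorem isPointOfInfiniteOrder_of_duplicationX {x₂ x₄ : ℚ}
    (hW : W = (legendreCurve L).map (algebraMap ℚ K))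
    (hx : x * (x - 1) * (x - L) ≠ 0) (hx₂ : duplicationX L x = x₂)
    (hf₂ : x₂ * (x₂ - 1) * (x₂ - L) ≠ 0) (hx₄ : duplicationX L x₂ = x₄)
    (h1 : 1 < padicNorm 2 x₄) (hL : padicNorm 2 L < padicNorm 2 x₄) {y : K}
    (hy : y ^ 2 = algebraMap ℚ K (x * (x - 1) * (x - L))) :
    IsPointOfInfiniteOrder W (algebraMap ℚ K x) y := by
  subst hx₂ hx₄
  have : CharZero K := algebraRat.charZero K
  have hns : W.toAffine.Nonsingular (algebraMap ℚ K x) y := by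
    rw [nonsingular_iff, equation_iff]
    have hy0 : y ≠ 0 := by
      rintro rfl
      rw [zero_pow two_ne_zero] at hy
      exact hx ((map_eq_zero _).mp hy.symm)
    subst hW
    simp only [WeierstrassCurve.map, legendreCurve, map_zero, map_neg, map_add, map_one]
    refine ⟨?_, Or.inr ?_⟩
    · simp only [map_mul, map_sub, map_one] at hy
      linear_combination hy
    · simpa using fun h => hy0 (self_eq_neg.mp h)
  refine ⟨hns, fun hfin => ?_⟩
  obtain ⟨y₂, h₂, e₂⟩ := two_nsmul_legendreCurve_map hW hx hns
  obtain ⟨y₄, h₄, e₄⟩ := two_nsmul_legendreCurve_map hW hf₂ h₂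
  refine not_isOfFinAddOrder_of_padicNorm_lt hW h1 hL h₄ ?_
  rw [← e₄, ← e₂]
  exact hfin.nsmul.nsmul

end InfiniteOrder

/-! ### 2-adic size of the quadrupled points. -/

section Estimates

variable {u L : ℚ}

theorem padicNorm_parameter (hL : L = (u ^ 2 + 3) * (u ^ 2 - 1) / (4 * u ^ 2)) :
    padicNorm 2 L =
      4 * padicNorm 2 (u ^ 2 + 3) * padicNorm 2 (u ^ 2 - 1) / padicNorm 2 (u ^ 2) := by
  rw [hL, padicNorm.div, padicNorm.mul, padicNorm.mul, padicNorm_two_four]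
  ring

/-- The `2`-adic sizes of `u² ± 1` and `u² ± 3`. -/
theorem padicNorm_two_sq_cases (u : ℚ) :
    (1 < padicNorm 2 (u ^ 2) ∧ padicNorm 2 (u ^ 2 - 1) = padicNorm 2 (u ^ 2) ∧
      padicNorm 2 (u ^ 2 + 1) = padicNorm 2 (u ^ 2) ∧
      padicNorm 2 (u ^ 2 - 3) = padicNorm 2 (u ^ 2) ∧
      padicNorm 2 (u ^ 2 + 3) = padicNorm 2 (u ^ 2)) ∨
    (padicNorm 2 (u ^ 2) < 1 ∧ padicNorm 2 (u ^ 2 - 1) = 1 ∧ padicNorm 2 (u ^ 2 + 1) = 1 ∧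
      padicNorm 2 (u ^ 2 - 3) = 1 ∧ padicNorm 2 (u ^ 2 + 3) = 1) ∨
    (padicNorm 2 (u ^ 2) = 1 ∧ padicNorm 2 (u ^ 2 - 1) ≤ 1 / 8 ∧
      padicNorm 2 (u ^ 2 + 1) = 1 / 2 ∧ padicNorm 2 (u ^ 2 - 3) = 1 / 2 ∧
      padicNorm 2 (u ^ 2 + 3) = 1 / 4) := by
  rcases lt_trichotomy 1 (padicNorm 2 (u ^ 2)) with h | h | h
  · refine Or.inl ⟨h, ?_, ?_, ?_, ?_⟩
    · exact padicNorm_sub_eq_left (by simpa using h)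
    · exact padicNorm_add_eq_left (by simpa using h)
    · exact padicNorm_sub_eq_left (by rwa [padicNorm_two_three])
    · exact padicNorm_add_eq_left (by rwa [padicNorm_two_three])
  · have hu : padicNorm 2 u = 1 := by
      rw [padicNorm_pow] at h
      exact (pow_eq_one_iff_of_nonneg (padicNorm.nonneg _) two_ne_zero).mp h.symm
    have h8 := padicNorm_two_sq_sub_one_le hu
    refine Or.inr (Or.inr ⟨h.symm, h8, ?_, ?_, ?_⟩)
    -- Since `|u² - 1|₂ ≤ 1/8`, it is negligible beside `2` and `4`.
    · rw [show u ^ 2 + 1 = 2 + (u ^ 2 - 1) by ring, padicNorm_add_eq_left, padicNorm_two_two]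
      rw [padicNorm_two_two]; linarith
    · rw [show u ^ 2 - 3 = -(2 - (u ^ 2 - 1)) by ring, padicNorm.neg, padicNorm_sub_eq_left,
        padicNorm_two_two]
      rw [padicNorm_two_two]; linarith
    · rw [show u ^ 2 + 3 = 4 + (u ^ 2 - 1) by ring, padicNorm_add_eq_left, padicNorm_two_four]
      rw [padicNorm_two_four]; linarith
  · refine Or.inr (Or.inl ⟨h, ?_, ?_, ?_, ?_⟩)
    · rw [← padicNorm.neg, neg_sub, padicNorm_sub_eq_left (by simpa using h), padicNorm.one]
    · rw [add_comm, padicNorm_add_eq_left (by simpa using h), padicNorm.one]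
    · rw [← padicNorm.neg, neg_sub, padicNorm_sub_eq_left (by rwa [padicNorm_two_three]),
        padicNorm_two_three]
    · rw [add_comm, padicNorm_add_eq_left (by rwa [padicNorm_two_three]), padicNorm_two_three]

/-- `2`-adic size of the fourth multiple of the point above the smaller critical point. -/
theorem padicNorm_quadruple_smaller (hu0 : u ≠ 0) (hu : u ^ 2 - 1 ≠ 0)
    (hL : L = (u ^ 2 + 3) * (u ^ 2 - 1) / (4 * u ^ 2)) {x : ℚ}
    (hx : x = ((u ^ 2 + 1) ^ 4 - 4 * u ^ 2 * (u ^ 2 + 3) * (u ^ 2 - 1)) ^ 2 /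
      (4 ^ 3 * u ^ 2 * (u ^ 2 - 1) ^ 2 * (u ^ 2 + 1) ^ 2)) :
    1 < padicNorm 2 x ∧ padicNorm 2 L < padicNorm 2 x := by
  have ht := padicNorm.nonzero (p := 2) (pow_ne_zero 2 hu0)
  have hd := padicNorm.nonzero (p := 2) hu
  have hpos : 0 < padicNorm 2 (u ^ 2) := lt_of_le_of_ne (padicNorm.nonneg _) ht.symm
  have hdpos : 0 < padicNorm 2 (u ^ 2 - 1) := lt_of_le_of_ne (padicNorm.nonneg _) hd.symm
  have e1 : padicNorm 2 ((u ^ 2 + 1) ^ 4) = padicNorm 2 (u ^ 2 + 1) ^ 4 := padicNorm_pow _ _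
  have e2 : padicNorm 2 (4 * u ^ 2 * (u ^ 2 + 3) * (u ^ 2 - 1)) = 1 / 4 * padicNorm 2 (u ^ 2) *
      padicNorm 2 (u ^ 2 + 3) * padicNorm 2 (u ^ 2 - 1) := by
    rw [padicNorm.mul, padicNorm.mul, padicNorm.mul, padicNorm_two_four]
  -- The fourth power dominates the numerator in all three cases; the factor `64` is `1 / |4 ^ 3|₂`.
  have key : padicNorm 2 (4 * u ^ 2 * (u ^ 2 + 3) * (u ^ 2 - 1)) < padicNorm 2 ((u ^ 2 + 1) ^ 4) →
      padicNorm 2 x = 64 * padicNorm 2 (u ^ 2 + 1) ^ 6 /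
        (padicNorm 2 (u ^ 2) * padicNorm 2 (u ^ 2 - 1) ^ 2) := by
    intro h
    have h1 : padicNorm 2 (u ^ 2 + 1) ≠ 0 := by
      intro h0
      rw [e1, h0, zero_pow (by norm_num)] at h
      exact (padicNorm.nonneg _).not_gt h
    rw [hx, padicNorm.div, padicNorm_pow, padicNorm_sub_eq_left h, e1, padicNorm.mul,
      padicNorm.mul, padicNorm.mul, padicNorm_pow 4, padicNorm_pow (_ - _), padicNorm_pow (_ + _),
      padicNorm_two_four]
    field_simp
    norm_num
  rw [padicNorm_parameter hL]
  rw [e1, e2] at key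
  rcases padicNorm_two_sq_cases u with ⟨h, h1, h2, -, h4⟩ | ⟨h, h1, h2, -, h4⟩ |
    ⟨h, h1, h2, -, h4⟩
  · simp only [h1, h2, h4] at key ⊢
    generalize padicNorm 2 (u ^ 2) = τ at *
    have h3 : 1 < τ ^ 3 := one_lt_pow₀ h (by norm_num)
    have h5 : 1 < τ ^ 2 := one_lt_pow₀ h (by norm_num)
    rw [key (by nlinarith)]
    constructor
    · rw [lt_div_iff₀ (by positivity)]; nlinarith
    · rw [div_lt_div_iff₀ (by positivity) (by positivity)]
      have h6 : 0 < τ ^ 5 := by positivity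
      nlinarith
  · simp only [h1, h2, h4] at key ⊢
    generalize padicNorm 2 (u ^ 2) = τ at *
    rw [key (by linarith)]
    constructor
    · rw [lt_div_iff₀ (by positivity)]; linarith
    · rw [div_lt_div_iff₀ (by positivity) (by positivity)]; linarith
  · simp only [h, h2, h4] at key ⊢
    generalize padicNorm 2 (u ^ 2 - 1) = δ at *
    rw [key (by linarith)]
    have h5 : δ ^ 2 ≤ 1 / 64 := by nlinarith
    constructor
    · rw [lt_div_iff₀ (by positivity)]; linarith
    · rw [div_lt_div_iff₀ (by positivity) (by positivity)]; nlinarith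

/-- `2`-adic size of the fourth multiple of the point above the larger critical point. -/
theorem padicNorm_quadruple_larger (hu0 : u ≠ 0)
    (hL : L = (u ^ 2 + 3) * (u ^ 2 - 1) / (4 * u ^ 2)) {x : ℚ}
    (hx : x = -((u ^ 2 - 3) ^ 4 - 4 * (3 * 3) * u ^ 2 * (u ^ 2 + 3) * (u ^ 2 - 1)) ^ 2 /
      (4 ^ 3 * 3 * (u ^ 2) ^ 3 * (u ^ 2 + 3) ^ 2 * (u ^ 2 - 3) ^ 2)) :
    1 < padicNorm 2 x ∧ padicNorm 2 L < padicNorm 2 x := by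
  have ht := padicNorm.nonzero (p := 2) (pow_ne_zero 2 hu0)
  have hpos : 0 < padicNorm 2 (u ^ 2) := lt_of_le_of_ne (padicNorm.nonneg _) ht.symm
  have e1 : padicNorm 2 ((u ^ 2 - 3) ^ 4) = padicNorm 2 (u ^ 2 - 3) ^ 4 := padicNorm_pow _ _
  have e2 : padicNorm 2 (4 * (3 * 3) * u ^ 2 * (u ^ 2 + 3) * (u ^ 2 - 1)) =
      1 / 4 * padicNorm 2 (u ^ 2) * padicNorm 2 (u ^ 2 + 3) * padicNorm 2 (u ^ 2 - 1) := by
    simp only [padicNorm.mul, padicNorm_two_four, padicNorm_two_three, mul_one]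
  have key : padicNorm 2 (4 * (3 * 3) * u ^ 2 * (u ^ 2 + 3) * (u ^ 2 - 1)) <
      padicNorm 2 ((u ^ 2 - 3) ^ 4) →
      padicNorm 2 x = 64 * padicNorm 2 (u ^ 2 - 3) ^ 6 /
        (padicNorm 2 (u ^ 2) ^ 3 * padicNorm 2 (u ^ 2 + 3) ^ 2) := by
    intro h
    have h1 : padicNorm 2 (u ^ 2 - 3) ≠ 0 := by
      intro h0
      rw [e1, h0, zero_pow (by norm_num)] at h
      exact (padicNorm.nonneg _).not_gt h
    rw [hx, padicNorm.div, padicNorm.neg, padicNorm_pow, padicNorm_sub_eq_left h, e1, padicNorm.mul,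
      padicNorm.mul, padicNorm.mul, padicNorm.mul, padicNorm_pow 4, padicNorm_pow (_ - _),
      padicNorm_pow (_ + _), padicNorm_pow (u ^ 2), padicNorm_two_four, padicNorm_two_three]
    have h3 : padicNorm 2 (u ^ 2 + 3) ≠ 0 := padicNorm.nonzero (by positivity)
    field_simp
    norm_num
  rw [padicNorm_parameter hL]
  rw [e1, e2] at key
  rcases padicNorm_two_sq_cases u with ⟨h, h1, -, h2, h4⟩ | ⟨h, h1, -, h2, h4⟩ |
    ⟨h, h1, -, h2, h4⟩
  · simp only [h1, h2, h4] at key ⊢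
    generalize padicNorm 2 (u ^ 2) = τ at *
    have h3 : 1 < τ ^ 3 := one_lt_pow₀ h (by norm_num)
    rw [key (by nlinarith)]
    have h6 : 0 < τ ^ 5 := by positivity
    constructor
    · rw [lt_div_iff₀ (by positivity)]; nlinarith
    · rw [div_lt_div_iff₀ (by positivity) (by positivity)]
      have h7 : 0 < τ ^ 7 := by positivity
      nlinarith
  · simp only [h1, h2, h4] at key ⊢
    generalize padicNorm 2 (u ^ 2) = τ at *
    have h3 : τ ^ 3 ≤ τ := pow_le_of_le_one hpos.le h.le (by norm_num)
    rw [key (by linarith)]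
    constructor
    · rw [lt_div_iff₀ (by positivity)]; linarith
    · rw [div_lt_div_iff₀ (by positivity) (by positivity)]; linarith
  · simp only [h, h2, h4] at key ⊢
    generalize padicNorm 2 (u ^ 2 - 1) = δ at *
    rw [key (by linarith)]
    norm_num
    linarith

/-- None of the three possible 2-adic norms of `u² - 3` is zero. -/
theorem sq_ne_three (u : ℚ) : u ^ 2 - 3 ≠ 0 := by
  intro h
  have h0 : padicNorm 2 (u ^ 2 - 3) = 0 := by rw [h, padicNorm.zero]
  rcases padicNorm_two_sq_cases u with ⟨h, -, -, h2, -⟩ | ⟨-, -, -, h2, -⟩ | ⟨-, -, -, h2, -⟩ <;>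
  · rw [h0] at h2
    linarith

end Estimates

/-! ### Critical points and the main theorem. -/

theorem roots_derivative_legendreCubic {L r s : ℚ} (h1 : 3 * (r + s) = 2 * (1 + L))
    (h2 : 3 * (r * s) = L) : (derivative (legendreCubic L)).roots = {r, s} := by
  have hd : derivative (legendreCubic L) = C 3 * ((X - C r) * (X - C s)) := by
    have e1 : (C 3 * (C r + C s) : ℚ[X]) = C 2 * (1 + C L) := by
      simp only [← C_add, ← C_mul, h1, ← C_1]
    have e2 : (C 3 * (C r * C s) : ℚ[X]) = C L := by
      simp only [← C_mul, h2]
    have c3 : (C 3 : ℚ[X]) = 3 := rfl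
    have c2 : (C 2 : ℚ[X]) = 2 := rfl
    rw [c3] at e1 e2 ⊢
    rw [c2] at e1
    simp only [legendreCubic, derivative_mul, derivative_sub, derivative_X, derivative_one,
      derivative_C]
    linear_combination X * e1 - e2
  rw [hd, roots_C_mul _ (by norm_num), roots_mul (mul_ne_zero (X_sub_C_ne_zero _)
    (X_sub_C_ne_zero _)), roots_X_sub_C, roots_X_sub_C]
  rfl

theorem eval_legendreCubic (L x : ℚ) : (legendreCubic L).eval x = x * (x - 1) * (x - L) := by
  simp [legendreCubic]

theorem legendreCurve_isElliptic {L : ℚ} (h0 : L ≠ 0) (h1 : L ≠ 1) :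
    (legendreCurve L).IsElliptic := by
  refine ⟨isUnit_iff_ne_zero.mpr ?_⟩
  have : (legendreCurve L).Δ = 16 * L ^ 2 * (L - 1) ^ 2 := by
    simp only [legendreCurve, WeierstrassCurve.Δ, WeierstrassCurve.b₂, WeierstrassCurve.b₄,
      WeierstrassCurve.b₆, WeierstrassCurve.b₈]
    ring
  rw [this]
  have := sub_ne_zero.mpr h1
  positivity

theorem isSquare_algebraMap_neg_three_mul_sq (a : ℚ) :
    IsSquare (algebraMap ℚ QSqrtNegThree (-3 * a ^ 2)) := by
  have hmem : ((Real.sqrt 3 : ℝ) : ℂ) * Complex.I ∈ QSqrtNegThree :=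
    IntermediateField.mem_adjoin_simple_self ℚ _
  refine ⟨⟨_, hmem⟩ * algebraMap ℚ QSqrtNegThree a, Subtype.ext ?_⟩
  have h3 : ((Real.sqrt 3 : ℝ) : ℂ) ^ 2 = 3 := by
    rw [← Complex.ofReal_pow, Real.sq_sqrt (by norm_num)]; norm_num
  change algebraMap ℚ ℂ (-3 * a ^ 2) = (((Real.sqrt 3 : ℝ) : ℂ) * Complex.I * algebraMap ℚ ℂ a) *
    (((Real.sqrt 3 : ℝ) : ℂ) * Complex.I * algebraMap ℚ ℂ a)
  simp only [map_mul, map_neg, map_pow, map_ofNat]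
  linear_combination (-(algebraMap ℚ ℂ a) ^ 2 * Complex.I ^ 2) * h3 -
    3 * (algebraMap ℚ ℂ a) ^ 2 * Complex.I_sq

theorem mainTheorem10 (u L : ℚ) (hu0 : u ≠ 0) (hu1 : u ≠ 1) (hu2 : u ≠ -1)
    (hL : L = (u ^ 2 + 3) * (u ^ 2 - 1) / (4 * u ^ 2)) :
    IsNiceParameter L ∧ (legendreCurve L).IsElliptic ∧
    ∃ r s : ℚ, r < s ∧ (derivative (legendreCubic L)).roots = {r, s} ∧
      -- the point above the smaller root `r` is rational and of infinite order
      (IsSquare ((legendreCubic L).eval r) ∧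
        ∀ y : ℚ, y ^ 2 = (legendreCubic L).eval r →
          IsPointOfInfiniteOrder (legendreCurve L) r y) ∧
      -- the point above the larger root `s` is defined over `ℚ(√-3)` and of infinite order
      (IsSquare (algebraMap ℚ QSqrtNegThree ((legendreCubic L).eval s)) ∧
        ∀ y : QSqrtNegThree, y ^ 2 = algebraMap ℚ QSqrtNegThree ((legendreCubic L).eval s) →
          IsPointOfInfiniteOrder ((legendreCurve L).map (algebraMap ℚ QSqrtNegThree))
            (algebraMap ℚ QSqrtNegThree s) y) := by
  have hm : u ^ 2 - 1 ≠ 0 := by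
    rw [show u ^ 2 - 1 = (u - 1) * (u + 1) by ring]
    exact mul_ne_zero (sub_ne_zero.mpr hu1) (fun h => hu2 (by linarith))
  have hp : u ^ 2 + 1 ≠ 0 := by positivity
  have hp3 : u ^ 2 + 3 ≠ 0 := by positivity
  have hm3 : u ^ 2 - 3 ≠ 0 := sq_ne_three u
  have hL0 : L ≠ 0 := by
    rw [hL]; positivity
  have hL1 : L - 1 ≠ 0 := by
    rw [show L - 1 = (u ^ 2 - 3) * (u ^ 2 + 1) / (4 * u ^ 2) by rw [hL]; field_simp; ring]
    positivity
  have hr : (u ^ 2 - 1) / (2 * u ^ 2) * ((u ^ 2 - 1) / (2 * u ^ 2) - 1) *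
      ((u ^ 2 - 1) / (2 * u ^ 2) - L) = ((u ^ 2 - 1) * (u ^ 2 + 1) / (4 * u ^ 3)) ^ 2 := by
    rw [hL]; field_simp; ring
  have hs : (u ^ 2 + 3) / 6 * ((u ^ 2 + 3) / 6 - 1) * ((u ^ 2 + 3) / 6 - L) =
      -3 * ((u ^ 2 + 3) * (u ^ 2 - 3) / (36 * u)) ^ 2 := by
    rw [hL]; field_simp; ring
  -- The critical points are `(1 + L ∓ √(L² - L + 1)) / 3`, and the root is `(u⁴ + 3) / (4u²)`.
  refine ⟨⟨hL0, sub_ne_zero.mp hL1, (u ^ 4 + 3) / (4 * u ^ 2), ?_⟩,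
    legendreCurve_isElliptic hL0 (sub_ne_zero.mp hL1),
    (u ^ 2 - 1) / (2 * u ^ 2), (u ^ 2 + 3) / 6, ?_, ?_, ⟨?_, ?_⟩, ⟨?_, ?_⟩⟩
  · rw [hL]; field_simp; ring
  · rw [← sub_pos, show (u ^ 2 + 3) / 6 - (u ^ 2 - 1) / (2 * u ^ 2) =
      (u ^ 4 + 3) / (6 * u ^ 2) by field_simp; ring]
    positivity
  · apply roots_derivative_legendreCubic
    · rw [hL]; field_simp; ring
    · rw [hL]; field_simp; ring
  · rw [eval_legendreCubic, hr]
    exact IsSquare.sq _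
  · intro y hy
    rw [eval_legendreCubic] at hy
    have hx₂ : duplicationX L ((u ^ 2 - 1) / (2 * u ^ 2)) = (u ^ 2 + 1) ^ 2 / (4 * u ^ 2) := by
      rw [duplicationX, hr, hL]; field_simp; ring
    -- The tangent at a critical point is horizontal, so `f_L` takes the same value at the doubled
    -- `x`-coordinate, which is `1 + L - 2r`.
    have hf₂ : (u ^ 2 + 1) ^ 2 / (4 * u ^ 2) * ((u ^ 2 + 1) ^ 2 / (4 * u ^ 2) - 1) *
        ((u ^ 2 + 1) ^ 2 / (4 * u ^ 2) - L) =
        ((u ^ 2 + 1) * (u ^ 2 - 1) / (4 * u ^ 3)) ^ 2 := by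
      rw [hL]; field_simp; ring
    obtain ⟨h1, h2⟩ := padicNorm_quadruple_smaller hu0 hm hL rfl
    refine isPointOfInfiniteOrder_of_duplicationX (K := ℚ) rfl ?_ hx₂ ?_ ?_ h1 h2 hy
    · rw [hr]; positivity
    · rw [hf₂]; positivity
    · rw [duplicationX, hf₂, hL]; field_simp
  · rw [eval_legendreCubic, hs]
    exact isSquare_algebraMap_neg_three_mul_sq _
  · intro y hy
    rw [eval_legendreCubic] at hy
    have hx₂ : duplicationX L ((u ^ 2 + 3) / 6) = -(u ^ 2 - 3) ^ 2 / (12 * u ^ 2) := by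
      rw [duplicationX, hs, hL]; field_simp; ring
    -- Again a horizontal tangent: this is the value `f_L(s)`.
    have hf₂ : -(u ^ 2 - 3) ^ 2 / (12 * u ^ 2) * (-(u ^ 2 - 3) ^ 2 / (12 * u ^ 2) - 1) *
        (-(u ^ 2 - 3) ^ 2 / (12 * u ^ 2) - L) =
        -3 * ((u ^ 2 + 3) * (u ^ 2 - 3) / (36 * u)) ^ 2 := by
      rw [hL]; field_simp; ring
    obtain ⟨h1, h2⟩ := padicNorm_quadruple_larger hu0 hL rfl
    refine isPointOfInfiniteOrder_of_duplicationX rfl ?_ hx₂ ?_ ?_ h1 h2 hy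
    · rw [hs]; positivity
    · rw [hf₂]; positivity
    · rw [duplicationX, hf₂, hL]; field_simp; ring
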